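/- Let $D\ge 3$ and $N\ge 2D$ be integers. The Johnson graph $J(N,D)$ has as vertex set $X$ the $D$-element subsets of $\{1,\dots,N\}$, with $x,y\in X$ adjacent whenever $|x\cap y|=D-1$. Let $\partial$ be the path-length distance, and put $\Gamma_i(x)=\{z\in X:\partial(x,z)=i\}$ for integers $i$ (so $\Gamma_{-1}(x)=\emptyset$). Let $V=\mathbb R^X$ with its standard Euclidean inner product and orthonormal basis $\{\hat x : x\in X\}$, and let $A$ be the adjacency matrix acting on $V$. Let $E=E_1$ be the primitive idempotent of $J(N,D)$ for the eigenvalue $\theta_1=(D-1)(N-D-1)-1$, that is, the orthogonal projection of $V$ onto the eigenspace of $A$ for $\theta_1$. For $x,y\in X$ with $\partial(x,y)=i$, put $$x^-_y=\sum_{z\in\Gamma_1(x)\cap\Gamma_{i-1}(y)}\hat z,\qquad x^+_y=\sum_{z\in\Gamma_1(x)\cap\Gamma_{i+1}(y)}\hat z .$$ For $u,v\in EV$ let $u\star v=E(u\circ v)$, where $u\circ v$ is the entrywise product (the Norton product). Then: (i) if $\partial(x,y)=i$ and $2\le i\le D$, then $E x^-_y=i(i-1)\,E\hat x+i\,E\hat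 y$; (ii) if $N=2D$, $\partial(x,y)=i$ and $1\le i\le D-1$, then $E x^+_y=(D-i)(D-i-1)\,E\hat x+(i-D)\,E\hat y$; (iii) in every case (for $N>2D$ as well as $N=2D$) the set $\{E\hat x : x\in X\}$ is Norton-balanced: for all $x,y\in X$ and $0\le i,j\le D$, $$\sum_{z\in\Gamma_i(x)\cap\Gamma_j(y)}E\hat z\in\operatorname{Span}\{E\hat x,\ E\hat y,\ E\hat x\star E\hat y\}.$$ -/

import Mathlib

/-- The Johnson graph `J(N, D)`: the vertices are the `D`-element subsets of an `N`-element set,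
and `x`, `y` are adjacent whenever `|x ∩ y| = D - 1`. -/
def johnsonGraph (N D : ℕ) : SimpleGraph {s : Finset (Fin N) // s.card = D} where
  Adj x y := (x.1 ∩ y.1).card + 1 = D
  symm := ⟨fun x y h => by rwa [Finset.inter_comm]⟩
  loopless := ⟨fun x h => by
    have hx := x.2
    rw [Finset.inter_self] at h
    omega⟩

namespace NortonBalanced

noncomputable section

variable {X : Type*} [Fintype X]

open scoped Classical in
/-- `Γ_i(x)`, the set of vertices at distance `i` from `x`. The index is an integer, so that
`Γ_{-1}(x)` makes sense (it is empty). -/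
def sphere (G : SimpleGraph X) (i : ℤ) (x : X) : Finset X :=
  Finset.univ.filter fun y => (G.dist x y : ℤ) = i

open scoped Classical in
/-- The basis vector `x̂` of the Euclidean space `V = ℝ^X`. -/
def hat (x : X) : EuclideanSpace ℝ X := EuclideanSpace.single x 1

open scoped Classical in
/-- The adjacency matrix `A` of `G`, acting on `V`. -/
def adjOp (G : SimpleGraph X) : Module.End ℝ (EuclideanSpace ℝ X) :=
  Matrix.toEuclideanLin (G.adjMatrix ℝ)

/-- The primitive idempotent of `G` for the eigenvalue `θ`: the orthogonal projection of `V` onto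
the eigenspace of the adjacency matrix for `θ`. -/
def primitiveIdempotent (G : SimpleGraph X) (θ : ℝ) :
    EuclideanSpace ℝ X →L[ℝ] EuclideanSpace ℝ X :=
  (Module.End.eigenspace (adjOp G) θ).starProjection

/-- `∑ ẑ` over `z ∈ Γ_i(x) ∩ Γ_j(y)`. -/
def sumInter (G : SimpleGraph X) (i j : ℤ) (x y : X) : EuclideanSpace ℝ X :=
  open scoped Classical in ∑ z ∈ sphere G i x ∩ sphere G j y, hat z

/-- `x^-_y`, the sum of `ẑ` over `z ∈ Γ(x) ∩ Γ_{i-1}(y)`, where `i = ∂(x, y)`. -/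
def xMinus (G : SimpleGraph X) (x y : X) : EuclideanSpace ℝ X :=
  sumInter G 1 ((G.dist x y : ℤ) - 1) x y

/-- `x^+_y`, the sum of `ẑ` over `z ∈ Γ(x) ∩ Γ_{i+1}(y)`, where `i = ∂(x, y)`. -/
def xPlus (G : SimpleGraph X) (x y : X) : EuclideanSpace ℝ X :=
  sumInter G 1 ((G.dist x y : ℤ) + 1) x y

/-- The entrywise product `u ∘ v` on `V`. -/
def entrywise (u v : EuclideanSpace ℝ X) : EuclideanSpace ℝ X :=
  WithLp.toLp 2 fun z => u z * v z

/-- The Norton product `u ⋆ v = E (u ∘ v)`. -/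
def nortonProduct (E : EuclideanSpace ℝ X →L[ℝ] EuclideanSpace ℝ X)
    (u v : EuclideanSpace ℝ X) : EuclideanSpace ℝ X :=
  E (entrywise u v)

/-- The set `{E x̂ | x ∈ X}` is Norton-balanced: for all `x`, `y` and all `i`, `j`, the sum of
`E ẑ` over `z ∈ Γ_i(x) ∩ Γ_j(y)` lies in `Span {E x̂, E ŷ, E x̂ ⋆ E ŷ}`. (If `i` or `j` exceeds
the diameter of `G`, then the sum is empty, so no bound on `i`, `j` is needed.) -/
def IsNortonBalanced (G : SimpleGraph X)
    (E : EuclideanSpace ℝ X →L[ℝ] EuclideanSpace ℝ X) : Prop :=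
  ∀ (x y : X) (i j : ℕ),
    (open scoped Classical in ∑ z ∈ sphere G i x ∩ sphere G j y, E (hat z)) ∈
      Submodule.span ℝ {E (hat x), E (hat y), nortonProduct E (E (hat x)) (E (hat y))}

/-- The eigenvalue `θ_i = (D - i)(N - D - i) - i` of `J(N, D)`. -/
def johnsonEigenvalue (N D i : ℕ) : ℝ :=
  ((D : ℝ) - i) * ((N : ℝ) - D - i) - i

/-- The primitive idempotent `E_i` of `J(N, D)` in the ordering `θ_0, θ_1, …, θ_D`. -/
def johnsonIdempotent (N D i : ℕ) :
    EuclideanSpace ℝ {s : Finset (Fin N) // s.card = D} →L[ℝ]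
      EuclideanSpace ℝ {s : Finset (Fin N) // s.card = D} :=
  primitiveIdempotent (johnsonGraph N D) (johnsonEigenvalue N D i)

end

end NortonBalanced

/-! The θ₁-eigenspace consists of the vectors `x ↦ ∑ a ∈ x, c a` with `∑ c = 0`
(`mem_eigenspace_johnsonGraph`). Hence `E v` depends only on the marginal of `v`, a function on the
ground set, modulo constants; the marginal of `x̂` is the indicator `1_x`. Every claim becomes a
comparison of functions on `Fin N`. For (i) and (ii), the neighbours involved are the exchanges of
some `a ∈ P` for some `b ∈ Q`, and their marginal is read off directly. For (iii), permutations
fixing `x` and `y` setwise show that the marginal of the sum over `Γ_i(x) ∩ Γ_j(y)` is `p 1_x + q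
1_y + c 1_{x∩y} + r` (`exists_marginal_sumInter`). Up to a nonzero scalar, the Norton product has a
marginal of the same shape with coefficient `γ` of `1_{x∩y}` (`exists_marginal_interVec`). If `N ≠
2D` then `γ ≠ 0`, so a multiple of it absorbs the `c` term; if `N = 2D`, complementation forces `c =
0`. -/

section

open Finset

/-! ### Exchanges and distance in the Johnson graph -/

/-- Summing over the neighbours of a vertex of `J(N, D)` amounts to summing over all ways to
exchange an element of it for one outside of it. -/
lemma sum_johnsonGraph_adj {N D : ℕ} (x : {s : Finset (Fin N) // s.card = D})
    (g : Finset (Fin N) → ℝ) [DecidableRel (johnsonGraph N D).Adj] :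
    ∑ z, (if (johnsonGraph N D).Adj x z then g z.1 else 0) =
      ∑ a ∈ x.1, ∑ b ∈ x.1ᶜ, g (insert b (x.1.erase a)) := by
  rw [← Finset.sum_filter, ← Finset.sum_product']
  symm
  have hx := x.2
  have hcard : ∀ p ∈ x.1 ×ˢ x.1ᶜ, (insert p.2 (x.1.erase p.1)).card = D := by
    rintro ⟨a, b⟩ hp
    simp only [mem_product, mem_compl] at hp
    rw [card_insert_of_notMem (fun h => hp.2 (mem_of_mem_erase h)), card_erase_add_one hp.1, hx]
  refine Finset.sum_bij (fun p hp => ⟨_, hcard p hp⟩) ?_ ?_ ?_ ?_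
  · rintro ⟨a, b⟩ hp
    simp only [mem_product, mem_compl] at hp
    simp only [mem_filter, mem_univ, true_and]
    change (x.1 ∩ insert b (x.1.erase a)).card + 1 = D
    rw [inter_insert_of_notMem hp.2, inter_eq_right.2 (erase_subset _ _), card_erase_add_one hp.1,
      hx]
  · rintro ⟨a, b⟩ hp ⟨a', b'⟩ hp' h
    simp only [mem_product, mem_compl] at hp hp'
    simp only [Subtype.mk.injEq, Finset.ext_iff, mem_insert, mem_erase] at h
    have h1 := h a
    have h2 := h b
    ext <;> grind
  · intro z hz
    simp only [mem_filter, mem_univ, true_and] at hz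
    have hz' : (x.1 ∩ z.1).card + 1 = D := hz
    have h1 := card_inter_add_card_sdiff x.1 z.1
    have h2 := card_inter_add_card_sdiff z.1 x.1
    rw [inter_comm] at h2
    have hzc := z.2
    obtain ⟨a, ha⟩ := card_eq_one.1 (show (x.1 \ z.1).card = 1 by omega)
    obtain ⟨b, hb⟩ := card_eq_one.1 (show (z.1 \ x.1).card = 1 by omega)
    simp only [Finset.ext_iff, mem_sdiff, mem_singleton] at ha hb
    refine ⟨(a, b), ?_, ?_⟩
    · simp only [mem_product, mem_compl]
      exact ⟨((ha a).2 rfl).1, ((hb b).2 rfl).2⟩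
    · apply Subtype.ext
      ext t
      have := ha t
      have := hb t
      simp only [mem_insert, mem_erase]
      grind
  · intros; rfl

lemma card_sdiff_eq {N D : ℕ} (x y : {s : Finset (Fin N) // s.card = D}) :
    (y.1 \ x.1).card = (x.1 \ y.1).card := by
  have h1 := card_inter_add_card_sdiff x.1 y.1
  have h2 := card_inter_add_card_sdiff y.1 x.1
  rw [inter_comm] at h2
  have := x.2
  have := y.2
  omega

lemma card_sdiff_le_length {N D : ℕ} {x y : {s : Finset (Fin N) // s.card = D}}
    (p : (johnsonGraph N D).Walk x y) : (x.1 \ y.1).card ≤ p.length := by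
  induction p with
  | nil => simp
  | @cons u v w h p ih =>
    have h' : (u.1 ∩ v.1).card + 1 = D := h
    have h1 := card_inter_add_card_sdiff u.1 v.1
    have hu := u.2
    have h2 : u.1 \ w.1 ⊆ (u.1 \ v.1) ∪ (v.1 \ w.1) := by
      intro t; simp only [mem_union, mem_sdiff]; tauto
    have h3 := (card_le_card h2).trans (card_union_le _ _)
    rw [SimpleGraph.Walk.length_cons]
    omega

lemma exists_walk_length {N D : ℕ} (n : ℕ) (x y : {s : Finset (Fin N) // s.card = D})
    (h : (x.1 \ y.1).card = n) : ∃ p : (johnsonGraph N D).Walk x y, p.length = n := by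
  induction n generalizing x with
  | zero =>
    have h1 : x.1 ⊆ y.1 := by simpa using h
    have h2 : x = y := Subtype.ext (eq_of_subset_of_card_le h1 (by rw [x.2, y.2]))
    subst h2
    exact ⟨.nil, rfl⟩
  | succ n ih =>
    have hx := x.2
    have h' := card_sdiff_eq x y
    obtain ⟨a, ha⟩ := card_pos.1 (show 0 < (x.1 \ y.1).card by omega)
    obtain ⟨b, hb⟩ := card_pos.1 (show 0 < (y.1 \ x.1).card by omega)
    rw [mem_sdiff] at ha hb
    let z : {s : Finset (Fin N) // s.card = D} := ⟨insert b (x.1.erase a), by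
      rw [card_insert_of_notMem (fun h => hb.2 (mem_of_mem_erase h)), card_erase_add_one ha.1, hx]⟩
    have hz : (z.1 \ y.1) = (x.1 \ y.1).erase a := by
      ext t; simp only [z, mem_sdiff, mem_insert, mem_erase]; grind
    obtain ⟨p, hp⟩ := ih z (by rw [hz, card_erase_of_mem (mem_sdiff.2 ha), h]; rfl)
    have hadj : (johnsonGraph N D).Adj x z := by
      change (x.1 ∩ insert b (x.1.erase a)).card + 1 = D
      rw [inter_insert_of_notMem hb.2, inter_eq_right.2 (erase_subset _ _),
        card_erase_add_one ha.1, hx]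
    exact ⟨.cons hadj p, by rw [SimpleGraph.Walk.length_cons, hp]⟩

lemma johnsonGraph_dist_eq {N D : ℕ} (x y : {s : Finset (Fin N) // s.card = D}) :
    (johnsonGraph N D).dist x y = (x.1 \ y.1).card := by
  obtain ⟨p, hp⟩ := exists_walk_length _ x y rfl
  refine le_antisymm (hp ▸ SimpleGraph.dist_le p) ?_
  obtain ⟨q, hq⟩ := SimpleGraph.Reachable.exists_walk_length_eq_dist ⟨p⟩
  exact hq ▸ card_sdiff_le_length q

/-! ### Superset sums and the eigenspace of θ₁ -/

/-- The number of neighbours of `x` in `J(N, D)` that contain `w`. -/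
lemma sum_superset_exchange {N D : ℕ} (x w : Finset (Fin N)) (hx : x.card = D) :
    ∑ a ∈ x, ∑ b ∈ xᶜ, (if w ⊆ insert b (x.erase a) then (1 : ℝ) else 0) =
      (((D : ℝ) - w.card) * (N - D) - w.card * (D - w.card + 1)) * (if w ⊆ x then 1 else 0) +
        (D - w.card + 1) * ∑ a ∈ w, (if w.erase a ⊆ x then 1 else 0) := by
  have h0 : ∀ a ∈ x, ∀ b ∈ xᶜ, (if w ⊆ insert b (x.erase a) then (1 : ℝ) else 0) =
      (if a ∉ w then 1 else 0) * (if w.erase b ⊆ x then 1 else 0) := by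
    intro a ha b hb
    rw [mem_compl] at hb
    suffices hiff : w ⊆ insert b (x.erase a) ↔ a ∉ w ∧ w.erase b ⊆ x by
      simp only [hiff, ite_and]
      split_ifs <;> simp
    refine ⟨fun h => ⟨fun haw => ?_, fun t ht => ?_⟩, fun h t ht => ?_⟩
    · have := h haw; grind
    · rw [mem_erase] at ht
      have := h ht.2; grind
    · by_cases htb : t = b
      · simp [htb]
      · have := h.2 (mem_erase.2 ⟨htb, ht⟩)
        grind
  rw [sum_congr rfl fun a ha => sum_congr rfl (h0 a ha)]
  simp_rw [← mul_sum]
  rw [← sum_mul]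
  have h1 : ∑ a ∈ x, (if a ∉ w then (1 : ℝ) else 0) = (x \ w).card := by
    rw [sum_boole, ← sdiff_eq_filter]
  have h2 : ((x ∩ w).card : ℝ) + (x \ w).card = D := by
    rw [← hx]; exact_mod_cast card_inter_add_card_sdiff x w
  rw [h1]
  by_cases hw : w ⊆ x
  · have hE : ∀ b, w.erase b ⊆ x := fun b => (erase_subset _ _).trans hw
    have hN : (x.card : ℝ) + xᶜ.card = N := by
      have := card_add_card_compl x
      rw [Fintype.card_fin] at this
      exact_mod_cast this
    rw [inter_eq_right.2 hw] at h2
    simp only [hE, hw, if_true, sum_const, nsmul_eq_mul, mul_one]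
    rw [← h2, ← hN, hx, ← h2]
    ring
  · rw [if_neg hw, mul_zero, zero_add, mul_sum, mul_sum]
    have hsub : ∀ b, w.erase b ⊆ x → b ∈ w ∧ b ∉ x := by
      intro b hb
      constructor
      · by_contra hbw
        rw [erase_eq_of_notMem hbw] at hb
        exact hw hb
      · intro hbx
        apply hw
        intro t ht
        by_cases htb : t = b
        · exact htb ▸ hbx
        · exact hb (mem_erase.2 ⟨htb, ht⟩)
    simp_rw [mul_ite, mul_one, mul_zero]
    rw [← sum_filter, ← sum_filter]
    -- As `w ⊄ x`, a valid `b` is the only element of `w \ x`, so both sums run over the same `b`.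
    have hfe : xᶜ.filter (fun b => w.erase b ⊆ x) = w.filter (fun b => w.erase b ⊆ x) := by
      ext b
      simp only [mem_filter, mem_compl]
      exact ⟨fun h => ⟨(hsub b h.2).1, h.2⟩, fun h => ⟨(hsub b h.2).2, h.2⟩⟩
    rw [hfe]
    refine sum_congr rfl fun b hb => ?_
    rw [mem_filter] at hb
    have hi : x ∩ w = w.erase b := by
      ext t
      have := @hb.2 t
      have := (hsub b hb.2).2
      simp only [mem_inter, mem_erase] at *
      grind
    have hc : ((w.erase b).card : ℝ) + 1 = w.card := by exact_mod_cast card_erase_add_one hb.1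
    rw [hi] at h2
    linarith

/-- The sum of the values of `v` on the vertices of `J(N, D)` that contain `w`. -/
noncomputable def supersetSum {N D : ℕ} (v : {s : Finset (Fin N) // s.card = D} → ℝ)
    (w : Finset (Fin N)) : ℝ :=
  ∑ z, if w ⊆ z.1 then v z else 0

/-- Double counting: pair the eigenvector equation with the indicator of the vertices containing `w`
and move the adjacency matrix onto that indicator. -/
lemma supersetSum_recursion {N D : ℕ} (v : {s : Finset (Fin N) // s.card = D} → ℝ) (θ : ℝ)
    [DecidableRel (johnsonGraph N D).Adj]
    (hv : ∀ x, ∑ z, (if (johnsonGraph N D).Adj x z then v z else 0) = θ * v x)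
    (w : Finset (Fin N)) :
    θ * supersetSum v w =
      (((D : ℝ) - w.card) * (N - D) - w.card * (D - w.card + 1)) * supersetSum v w +
        (D - w.card + 1) * ∑ a ∈ w, supersetSum v (w.erase a) := by
  have h1 : θ * supersetSum v w = ∑ z, v z *
      ∑ x, if (johnsonGraph N D).Adj z x then (if w ⊆ x.1 then 1 else 0) else 0 := by
    unfold supersetSum
    rw [mul_sum]
    calc _ = ∑ x, ∑ z, if (johnsonGraph N D).Adj z x then (if w ⊆ x.1 then v z else 0) else 0 := by
          refine sum_congr rfl fun x _ => ?_
          by_cases h : w ⊆ x.1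
          · simp only [h, if_true, ← hv x, SimpleGraph.adj_comm]
          · simp [h]
      _ = _ := by
          rw [sum_comm]
          refine sum_congr rfl fun z _ => ?_
          rw [mul_sum]
          refine sum_congr rfl fun x _ => ?_
          split_ifs <;> simp
  rw [h1]
  have h2 : ∀ z : {s : Finset (Fin N) // s.card = D}, v z *
      ∑ x, (if (johnsonGraph N D).Adj z x then (if w ⊆ x.1 then (1 : ℝ) else 0) else 0) =
      (((D : ℝ) - w.card) * (N - D) - w.card * (D - w.card + 1)) *
        (if w ⊆ z.1 then v z else 0) +
        (D - w.card + 1) * ∑ a ∈ w, (if w.erase a ⊆ z.1 then v z else 0) := by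
    intro z
    rw [sum_johnsonGraph_adj z (fun s => if w ⊆ s then (1 : ℝ) else 0),
      sum_superset_exchange z.1 w z.2, mul_add, mul_left_comm, mul_left_comm (v z), mul_sum]
    simp only [mul_ite, mul_one, mul_zero]
  rw [sum_congr rfl fun z _ => h2 z, sum_add_distrib, ← mul_sum, ← mul_sum, sum_comm]
  rfl

/-- For θ₁ the recursion kills the total sum, leaves the singleton sums free, and determines the
sums at all larger sets from them, linearly. At a set of size `D` the superset sum is the value of
`v` itself. -/
lemma exists_coeff_of_eigenvector {N D : ℕ} (hN : D < N)
    (v : {s : Finset (Fin N) // s.card = D} → ℝ) [DecidableRel (johnsonGraph N D).Adj]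
    (hv : ∀ x, ∑ z, (if (johnsonGraph N D).Adj x z then v z else 0) =
      NortonBalanced.johnsonEigenvalue N D 1 * v x) (hD : 1 ≤ D) :
    ∃ c : Fin N → ℝ, ∑ a, c a = 0 ∧ ∀ x, v x = ∑ a ∈ x.1, c a := by
  have hrec := supersetSum_recursion v _ hv
  have hθ : NortonBalanced.johnsonEigenvalue N D 1 = (D : ℝ) * (N - D) - N := by
    simp only [NortonBalanced.johnsonEigenvalue, Nat.cast_one]; ring
  have hN' : (N : ℝ) ≠ 0 := by
    have : N ≠ 0 := by omega
    exact_mod_cast this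
  have h0 : supersetSum v ∅ = 0 := by
    have := hrec ∅
    simp only [card_empty, Nat.cast_zero, sum_empty, hθ] at this
    have h : (N : ℝ) * supersetSum v ∅ = 0 := by linarith
    exact (mul_eq_zero.1 h).resolve_left hN'
  have hstep : ∀ j, 1 ≤ j → j ≤ D → ∃ κ : ℝ, ∀ w : Finset (Fin N), w.card = j →
      supersetSum v w = κ * ∑ a ∈ w, supersetSum v {a} := by
    intro j hj
    induction j, hj using Nat.le_induction with
    | base =>
      intro _
      refine ⟨1, fun w hw => ?_⟩
      obtain ⟨a, rfl⟩ := card_eq_one.1 hw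
      simp
    | succ j hj ih =>
      intro hjD
      obtain ⟨κ, hκ⟩ := ih (by omega)
      -- At size `j + 1`, θ₁ minus the diagonal coefficient of the recursion is `j (N - (j + 1))`,
      -- nonzero because `1 ≤ j` and `j + 1 ≤ D < N`.
      refine ⟨(D - j) * (κ * j) / (j * (N - (j + 1))), fun w hw => ?_⟩
      have hr := hrec w
      have hsum : ∑ a ∈ w, supersetSum v (w.erase a) =
          κ * (j * ∑ a ∈ w, supersetSum v {a}) := by
        have : ∀ a ∈ w, supersetSum v (w.erase a) =
            κ * (∑ b ∈ w, supersetSum v {b} - supersetSum v {a}) := by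
          intro a ha
          rw [hκ _ (by rw [card_erase_of_mem ha, hw]; rfl), ← add_sum_erase w _ ha]
          ring
        rw [sum_congr rfl this, ← mul_sum, sum_sub_distrib, sum_const, hw, nsmul_eq_mul]
        push_cast
        ring
      rw [hsum, hθ, hw] at hr
      push_cast at hr
      have hj0 : (j : ℝ) ≠ 0 := by
        have : j ≠ 0 := by omega
        exact_mod_cast this
      have hNj : (N : ℝ) - (j + 1) ≠ 0 := by
        have : ((j + 1 : ℕ) : ℝ) < N := by exact_mod_cast (by omega : j + 1 < N)
        push_cast at this
        linarith
      rw [div_mul_eq_mul_div, eq_div_iff (mul_ne_zero hj0 hNj)]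
      linear_combination hr
  obtain ⟨κ, hκ⟩ := hstep D hD le_rfl
  refine ⟨fun a => κ * supersetSum v {a}, ?_, fun x => ?_⟩
  · rw [← mul_sum]
    have : ∑ a, supersetSum v {a} = D * supersetSum v ∅ := by
      unfold supersetSum
      rw [sum_comm, mul_sum]
      refine sum_congr rfl fun z _ => ?_
      rw [← sum_filter]
      simp [z.2]
    rw [this, h0, mul_zero, mul_zero]
  · rw [← mul_sum, ← hκ x.1 x.2]
    unfold supersetSum
    rw [sum_eq_single x]
    · simp
    · intro z _ hz
      refine if_neg fun h => hz (Subtype.ext ?_)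
      exact (eq_of_subset_of_card_le h (by rw [x.2, z.2])).symm
    · simp

namespace NortonBalanced

lemma mem_eigenspace_johnsonGraph {N D : ℕ} (hD : 1 ≤ D) (hN : D < N)
    (v : EuclideanSpace ℝ {s : Finset (Fin N) // s.card = D}) :
    v ∈ Module.End.eigenspace (adjOp (johnsonGraph N D)) (johnsonEigenvalue N D 1) ↔
      ∃ c : Fin N → ℝ, ∑ a, c a = 0 ∧ ∀ x, v x = ∑ a ∈ x.1, c a := by
  classical
  have key : v ∈ Module.End.eigenspace (adjOp (johnsonGraph N D)) (johnsonEigenvalue N D 1) ↔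
      ∀ x, ∑ z, (if (johnsonGraph N D).Adj x z then v z else 0) =
        johnsonEigenvalue N D 1 * v x := by
    rw [Module.End.mem_eigenspace_iff, PiLp.ext_iff]
    refine forall_congr' fun x => ?_
    simp only [adjOp, Matrix.toLpLin_apply, Matrix.mulVec, dotProduct, PiLp.smul_apply, smul_eq_mul,
      SimpleGraph.adjMatrix_apply, ite_mul, one_mul, zero_mul]
  rw [key]
  refine ⟨fun h => exists_coeff_of_eigenvector hN v h hD, ?_⟩
  rintro ⟨c, hc, hv⟩ x
  simp only [hv]
  rw [sum_johnsonGraph_adj x (fun s => ∑ a ∈ s, c a)]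
  have h1 : ∀ a ∈ x.1, ∀ b ∈ x.1ᶜ, ∑ t ∈ insert b (x.1.erase a), c t =
      c b + (∑ t ∈ x.1, c t - c a) := by
    intro a ha b hb
    rw [mem_compl] at hb
    rw [sum_insert (fun h => hb (mem_of_mem_erase h)), ← add_sum_erase x.1 c ha]
    ring
  rw [sum_congr rfl fun a ha => sum_congr rfl (h1 a ha)]
  have h2 : ∑ t ∈ x.1ᶜ, c t = - ∑ t ∈ x.1, c t := by
    rw [← sum_add_sum_compl x.1 c] at hc; linarith
  have h3 : (x.1ᶜ.card : ℝ) = N - D := by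
    have h := card_add_card_compl x.1
    rw [Fintype.card_fin, x.2] at h
    rw [eq_sub_iff_add_eq, add_comm]
    exact_mod_cast h
  simp only [sum_add_distrib, sum_const, sum_sub_distrib, h2, nsmul_eq_mul, h3, x.2, ← mul_sum,
    johnsonEigenvalue]
  push_cast
  ring

/-! ### Marginals determine the projection -/

/-- The element-wise marginal of a vector `v`: at `a` it is the sum of `v z` over the vertices `z`
that contain `a`. -/
noncomputable def marginal {N D : ℕ} :
    EuclideanSpace ℝ {s : Finset (Fin N) // s.card = D} →ₗ[ℝ] (Fin N → ℝ) where
  toFun v a := ∑ z, if a ∈ z.1 then v z else 0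
  map_add' u v := by
    ext a
    simp only [Pi.add_apply, PiLp.add_apply, ← sum_add_distrib]
    exact sum_congr rfl fun z _ => by split_ifs <;> simp
  map_smul' r v := by
    ext a
    simp only [Pi.smul_apply, PiLp.smul_apply, smul_eq_mul, mul_sum, RingHom.id_apply]
    exact sum_congr rfl fun z _ => by split_ifs <;> simp

lemma marginal_apply {N D : ℕ} (v : EuclideanSpace ℝ {s : Finset (Fin N) // s.card = D})
    (a : Fin N) : marginal v a = ∑ z, if a ∈ z.1 then v z else 0 := rfl

lemma marginal_hat {N D : ℕ} (x : {s : Finset (Fin N) // s.card = D}) (a : Fin N) :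
    marginal (hat x) a = if a ∈ x.1 then 1 else 0 := by
  rw [marginal_apply, sum_eq_single x]
  · simp [hat]
  · intro z _ hz
    simp [hat, hz]
  · simp

lemma marginal_sum_hat {N D : ℕ} (T : Finset {s : Finset (Fin N) // s.card = D}) (a : Fin N) :
    marginal (∑ z ∈ T, hat z) a = ∑ z ∈ T, if a ∈ z.1 then 1 else 0 := by
  rw [map_sum, Finset.sum_apply]
  exact sum_congr rfl fun z _ => marginal_hat z a

/-- The inner product of `v` with the eigenvector of weights `c` is `∑ a, c a * marginal v a`, which
vanishes for a constant marginal since `∑ c = 0`. -/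
lemma johnsonIdempotent_eq_zero {N D : ℕ} (hD : 1 ≤ D) (hN : D < N)
    (v : EuclideanSpace ℝ {s : Finset (Fin N) // s.card = D}) (r : ℝ)
    (hv : ∀ a, marginal v a = r) : johnsonIdempotent N D 1 v = 0 := by
  unfold johnsonIdempotent primitiveIdempotent
  rw [Submodule.starProjection_apply_eq_zero_iff, Submodule.mem_orthogonal]
  intro u hu
  obtain ⟨c, hc, hu⟩ := (mem_eigenspace_johnsonGraph hD hN u).1 hu
  rw [PiLp.inner_apply]
  simp only [hu, RCLike.inner_apply, conj_trivial, mul_sum]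
  have h : ∀ z : {s : Finset (Fin N) // s.card = D}, ∑ a ∈ z.1, v z * c a =
      ∑ a, c a * (if a ∈ z.1 then v z else 0) := by
    intro z
    simp only [mul_ite, mul_zero, sum_ite_mem, univ_inter]
    exact sum_congr rfl fun a _ => mul_comm _ _
  rw [sum_congr rfl fun z _ => h z, sum_comm]
  simp only [← mul_sum, ← marginal_apply, hv, ← sum_mul, hc, zero_mul]

lemma johnsonIdempotent_eq_combination {N D : ℕ} (hD : 1 ≤ D) (hN : D < N)
    (v : EuclideanSpace ℝ {s : Finset (Fin N) // s.card = D})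
    (x y : {s : Finset (Fin N) // s.card = D}) (p q r : ℝ)
    (hv : ∀ a, marginal v a =
      p * (if a ∈ x.1 then 1 else 0) + q * (if a ∈ y.1 then 1 else 0) + r) :
    johnsonIdempotent N D 1 v =
      p • johnsonIdempotent N D 1 (hat x) + q • johnsonIdempotent N D 1 (hat y) := by
  rw [← sub_eq_zero, ← map_smul, ← map_smul, ← map_add, ← map_sub]
  refine johnsonIdempotent_eq_zero hD hN _ r fun a => ?_
  rw [map_sub, map_add, map_smul, map_smul, Pi.sub_apply, Pi.add_apply, Pi.smul_apply,
    Pi.smul_apply, marginal_hat, marginal_hat, hv, smul_eq_mul, smul_eq_mul]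
  ring

/-! ### Marginals of sums over spheres, and claims (i) and (ii) -/

lemma mem_sphere_johnsonGraph {N D : ℕ} (x y : {s : Finset (Fin N) // s.card = D}) (i : ℤ) :
    y ∈ sphere (johnsonGraph N D) i x ↔ ((x.1 ∩ y.1).card : ℤ) = D - i := by
  have h := card_inter_add_card_sdiff x.1 y.1
  rw [x.2] at h
  simp only [sphere, mem_filter, mem_univ, true_and, johnsonGraph_dist_eq]
  omega

lemma marginal_sumInter {N D : ℕ} (x y : {s : Finset (Fin N) // s.card = D}) (i j : ℤ)
    (e : Fin N) :
    marginal (sumInter (johnsonGraph N D) i j x y) e =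
      ∑ z : {s : Finset (Fin N) // s.card = D}, if (((x.1 ∩ z.1).card : ℤ) = D - i ∧
        ((y.1 ∩ z.1).card : ℤ) = D - j) ∧ e ∈ z.1 then 1 else 0 := by
  classical
  rw [sumInter, marginal_sum_hat, ← sum_filter, ← sum_filter]
  refine sum_congr ?_ fun _ _ => rfl
  ext z
  simp only [mem_filter, mem_inter, mem_univ, true_and, mem_sphere_johnsonGraph]

lemma marginal_sumInter_one {N D : ℕ} (x y : {s : Finset (Fin N) // s.card = D}) (j : ℤ)
    (e : Fin N) :
    marginal (sumInter (johnsonGraph N D) 1 j x y) e =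
      ∑ a ∈ x.1, ∑ b ∈ x.1ᶜ, if ((y.1 ∩ insert b (x.1.erase a)).card : ℤ) = D - j ∧
        e ∈ insert b (x.1.erase a) then 1 else 0 := by
  classical
  rw [← sum_johnsonGraph_adj x (fun s => if ((y.1 ∩ s).card : ℤ) = D - j ∧ e ∈ s then 1 else 0),
    marginal_sumInter]
  refine sum_congr rfl fun z _ => ?_
  rw [← ite_and]
  refine if_congr ?_ rfl rfl
  rw [and_assoc]
  refine and_congr_left fun _ => ?_
  change _ ↔ (x.1 ∩ z.1).card + 1 = D
  omega

/-- Each exchange has indicator `1_x - 1_{a} + 1_{b}`; sum this over `P × Q`. -/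
lemma sum_mem_exchange {N : ℕ} (x P Q : Finset (Fin N)) (hP : P ⊆ x) (hQ : Q ⊆ xᶜ) (e : Fin N) :
    ∑ a ∈ P, ∑ b ∈ Q, (if e ∈ insert b (x.erase a) then (1 : ℝ) else 0) =
      P.card * (if e ∈ Q then 1 else 0) + P.card * Q.card * (if e ∈ x then 1 else 0) -
        Q.card * (if e ∈ P then 1 else 0) := by
  have h : ∀ a ∈ P, ∀ b ∈ Q, (if e ∈ insert b (x.erase a) then (1 : ℝ) else 0) =
      (if e = b then 1 else 0) + (if e ∈ x then 1 else 0) - (if e = a then 1 else 0) := by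
    intro a ha b hb
    have ha' := hP ha
    have hb' := mem_compl.1 (hQ hb)
    have hab : a ≠ b := fun h => hb' (h ▸ ha')
    by_cases h1 : e = b
    · subst h1; simp [hb', hab.symm]
    · by_cases h2 : e = a
      · subst h2; simp [ha', hab]
      · simp [h1, h2]
  rw [sum_congr rfl fun a ha => sum_congr rfl (h a ha)]
  simp only [sum_sub_distrib, sum_add_distrib, sum_ite_eq, sum_const, nsmul_eq_mul, ← mul_sum]
  ring

lemma marginal_sumInter_one_of_subset {N D : ℕ} (x y : {s : Finset (Fin N) // s.card = D}) (j : ℤ)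
    (P Q : Finset (Fin N)) (hP : P ⊆ x.1) (hQ : Q ⊆ x.1ᶜ)
    (h : ∀ a ∈ x.1, ∀ b ∈ x.1ᶜ, ((y.1 ∩ insert b (x.1.erase a)).card : ℤ) = D - j ↔
      a ∈ P ∧ b ∈ Q) (e : Fin N) :
    marginal (sumInter (johnsonGraph N D) 1 j x y) e =
      P.card * (if e ∈ Q then 1 else 0) + P.card * Q.card * (if e ∈ x.1 then 1 else 0) -
        Q.card * (if e ∈ P then 1 else 0) := by
  rw [marginal_sumInter_one, ← sum_mem_exchange x.1 P Q hP hQ e]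
  rw [← sum_product', ← sum_product', ← sum_subset (product_subset_product hP hQ)]
  · refine sum_congr rfl fun p hp => if_congr ?_ rfl rfl
    rw [mem_product] at hp
    rw [h _ (hP hp.1) _ (hQ hp.2)]
    exact and_iff_right hp
  · intro p hp hp'
    rw [mem_product] at hp hp'
    exact if_neg fun hh => hp' ((h _ hp.1 _ hp.2).1 hh.1)

lemma card_inter_exchange {N : ℕ} (x y : Finset (Fin N)) {a b : Fin N} (ha : a ∈ x) (hb : b ∉ x) :
    ((y ∩ insert b (x.erase a)).card : ℤ) =
      (x ∩ y).card - (if a ∈ y then 1 else 0) + (if b ∈ y then 1 else 0) := by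
  have h1 : ((y ∩ x.erase a).card : ℤ) = (x ∩ y).card - (if a ∈ y then 1 else 0) := by
    rw [inter_erase, inter_comm y x]
    split_ifs with h
    · rw [← card_erase_add_one (mem_inter.2 ⟨ha, h⟩)]; simp
    · rw [erase_eq_of_notMem (fun h' => h (mem_inter.1 h').2)]; simp
  rw [← h1]
  split_ifs with h
  · rw [inter_insert_of_mem h, card_insert_of_notMem]
    · push_cast; ring
    · simp [hb]
  · rw [inter_insert_of_notMem h, add_zero]

/-- Approaching `y` means exchanging `a ∈ x \ y` for `b ∈ y \ x`, both sets of size `i`. The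
marginal is `i² 1_x + i (1_{y\x} - 1_{x\y})`, and the bracket equals `1_y - 1_x`. -/
lemma johnsonIdempotent_xMinus {N D : ℕ} (hD : 1 ≤ D) (hN : D < N)
    (x y : {s : Finset (Fin N) // s.card = D}) (i : ℕ) (hi : (johnsonGraph N D).dist x y = i) :
    johnsonIdempotent N D 1 (xMinus (johnsonGraph N D) x y) =
      ((i : ℝ) * ((i : ℝ) - 1)) • johnsonIdempotent N D 1 (hat x) +
        (i : ℝ) • johnsonIdempotent N D 1 (hat y) := by
  rw [xMinus, hi]
  rw [johnsonGraph_dist_eq] at hi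
  have hc := card_inter_add_card_sdiff x.1 y.1
  rw [x.2] at hc
  refine johnsonIdempotent_eq_combination hD hN _ x y _ _ 0 fun e => ?_
  rw [marginal_sumInter_one_of_subset x y _ (x.1 \ y.1) (y.1 \ x.1) sdiff_subset
    (fun t ht => mem_compl.2 (mem_sdiff.1 ht).2), card_sdiff_eq x y, hi]
  · simp only [mem_sdiff]
    by_cases h1 : e ∈ x.1 <;> by_cases h2 : e ∈ y.1 <;> simp [h1, h2] <;> ring
  · intro a ha b hb
    rw [mem_compl] at hb
    rw [card_inter_exchange x.1 y.1 ha hb, mem_sdiff, mem_sdiff]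
    by_cases h1 : a ∈ y.1 <;> by_cases h2 : b ∈ y.1 <;> simp [h1, h2, ha, hb] <;> omega

/-- Receding from `y` means exchanging `a ∈ x ∩ y` for `b ∉ x ∪ y`. For `N = 2D` both sets have size
`D - i`, so the `1_{x∩y}` terms cancel and only the constant `D - i` is left over. -/
lemma johnsonIdempotent_xPlus {N D : ℕ} (hD : 1 ≤ D) (hN : N = 2 * D)
    (x y : {s : Finset (Fin N) // s.card = D}) (i : ℕ) (hi : (johnsonGraph N D).dist x y = i) :
    johnsonIdempotent N D 1 (xPlus (johnsonGraph N D) x y) =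
      (((D : ℝ) - i) * ((D : ℝ) - i - 1)) • johnsonIdempotent N D 1 (hat x) +
        ((i : ℝ) - D) • johnsonIdempotent N D 1 (hat y) := by
  rw [xPlus, hi]
  rw [johnsonGraph_dist_eq] at hi
  have hc := card_inter_add_card_sdiff x.1 y.1
  rw [x.2, hi] at hc
  have hc2 : (x.1ᶜ \ y.1).card + i = D := by
    have h1 := card_inter_add_card_sdiff x.1ᶜ y.1
    have h2 : x.1ᶜ ∩ y.1 = y.1 \ x.1 := by ext; simp [and_comm]
    have h3 := card_add_card_compl x.1
    rw [Fintype.card_fin, x.2] at h3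
    rw [h2, card_sdiff_eq, hi] at h1
    omega
  have hc' : ((x.1 ∩ y.1).card : ℝ) = D - i := by
    rw [eq_sub_iff_add_eq]; exact_mod_cast hc
  have hc2' : ((x.1ᶜ \ y.1).card : ℝ) = D - i := by
    rw [eq_sub_iff_add_eq]; exact_mod_cast hc2
  refine johnsonIdempotent_eq_combination hD (by omega) _ x y _ _ ((D : ℝ) - i) fun e => ?_
  rw [marginal_sumInter_one_of_subset x y _ (x.1 ∩ y.1) (x.1ᶜ \ y.1) inter_subset_left
    sdiff_subset, hc', hc2']
  · simp only [mem_sdiff, mem_inter, mem_compl]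
    by_cases h1 : e ∈ x.1 <;> by_cases h2 : e ∈ y.1 <;> simp [h1, h2] <;> ring
  · intro a ha b hb
    rw [mem_compl] at hb
    rw [card_inter_exchange x.1 y.1 ha hb, mem_sdiff, mem_inter, mem_compl]
    by_cases h1 : a ∈ y.1 <;> by_cases h2 : b ∈ y.1 <;> simp [h1, h2, ha, hb] <;> omega

/-! ### Triple counts and the marginal of the Norton product -/

/-- The all-ones vector is an eigenvector for the valency `D (N - D)`, so the general recursion
applies. -/
lemma supersetSum_one_recursion {N D : ℕ} (w : Finset (Fin N)) (hw : 1 ≤ w.card)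
    (hwN : w.card ≤ N) (t : ℝ)
    (ht : ∀ a ∈ w, supersetSum (D := D) (fun _ => 1) (w.erase a) = t) :
    supersetSum (D := D) (fun _ => 1) w = (D - w.card + 1) / (N - w.card + 1) * t := by
  classical
  have h := supersetSum_recursion (N := N) (D := D) (fun _ => 1) (D * (N - D)) (fun x => by
    rw [sum_johnsonGraph_adj x (fun _ => 1)]
    have hc : (x.1ᶜ.card : ℝ) = N - D := by
      have h := card_add_card_compl x.1
      rw [Fintype.card_fin, x.2] at h
      rw [eq_sub_iff_add_eq, add_comm]
      exact_mod_cast h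
    simp [hc, x.2, mul_sub]) w
  rw [sum_congr rfl ht, sum_const, nsmul_eq_mul] at h
  have h1 : (w.card : ℝ) ≠ 0 := by
    have : w.card ≠ 0 := by omega
    exact_mod_cast this
  have h2 : (N : ℝ) - w.card + 1 ≠ 0 := by
    have : (w.card : ℝ) ≤ N := by exact_mod_cast hwN
    linarith
  rw [div_mul_eq_mul_div, eq_div_iff h2]
  apply mul_left_cancel₀ h1
  linear_combination h

/-- The numbers of vertices of `J(N, D)` through one, two, or three given elements. -/
lemma exists_supersetSum_one {N D : ℕ} (hD : 1 ≤ D) (hN : D < N) (hN3 : 3 ≤ N) :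
    ∃ n₁ n₂ n₃ : ℝ, n₁ ≠ n₂ ∧ (N ≠ 2 * D → n₁ - 3 * n₂ + 2 * n₃ ≠ 0) ∧
      ∀ a b c : Fin N, supersetSum (D := D) (fun _ => 1) {a, b, c} =
        n₃ + (n₂ - n₃) * ((if a = b then 1 else 0) + (if a = c then 1 else 0) +
          (if b = c then 1 else 0)) +
          (n₁ - 3 * n₂ + 2 * n₃) * ((if a = b then 1 else 0) * (if a = c then 1 else 0)) := by
  set n₀ : ℝ := supersetSum (N := N) (D := D) (fun _ => 1) ∅ with hn₀
  have hn₀pos : n₀ ≠ 0 := by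
    have : n₀ = Fintype.card {s : Finset (Fin N) // s.card = D} := by
      simp [hn₀, supersetSum]
    rw [this, Fintype.card_finset_len, Fintype.card_fin]
    exact_mod_cast (Nat.choose_pos hN.le).ne'
  have h1 : ∀ a : Fin N, supersetSum (D := D) (fun _ => 1) {a} = D / N * n₀ := by
    intro a
    rw [supersetSum_one_recursion {a} (by simp) (by simp; omega) n₀]
    · simp
    · intro b hb
      rw [mem_singleton] at hb
      subst hb
      simp [hn₀]
  have h2 : ∀ a b : Fin N, a ≠ b → supersetSum (D := D) (fun _ => 1) {a, b} =
      (D - 1) / (N - 1) * (D / N * n₀) := by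
    intro a b hab
    rw [supersetSum_one_recursion {a, b} (by simp [hab]) (by simp [hab]; omega) (D / N * n₀)]
    · rw [card_pair hab]; push_cast; congr 2 <;> ring
    · intro c hc
      obtain ⟨d, hd⟩ := card_eq_one.1 (show (({a, b} : Finset (Fin N)).erase c).card = 1 by
        rw [card_erase_of_mem hc, card_pair hab])
      rw [hd, h1]
  have h3 : ∀ a b c : Fin N, a ≠ b → a ≠ c → b ≠ c → supersetSum (D := D) (fun _ => 1) {a, b, c} =
      (D - 2) / (N - 2) * ((D - 1) / (N - 1) * (D / N * n₀)) := by
    intro a b c hab hac hbc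
    have hcard : ({a, b, c} : Finset (Fin N)).card = 3 :=
      card_eq_three.2 ⟨a, b, c, hab, hac, hbc, rfl⟩
    rw [supersetSum_one_recursion {a, b, c} (by omega) (by omega)
      ((D - 1) / (N - 1) * (D / N * n₀))]
    · rw [hcard]; push_cast; congr 2 <;> ring
    · intro d hd
      obtain ⟨e, f, hef, hd⟩ := card_eq_two.1
        (show (({a, b, c} : Finset (Fin N)).erase d).card = 2 by
          rw [card_erase_of_mem hd, hcard])
      rw [hd, h2 _ _ hef]
  have hNr : (3 : ℝ) ≤ N := by exact_mod_cast hN3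
  have hDr : (1 : ℝ) ≤ D := by exact_mod_cast hD
  have hDN : (D : ℝ) < N := by exact_mod_cast hN
  have hN0 : (N : ℝ) ≠ 0 := by linarith
  have hN1 : (N : ℝ) - 1 ≠ 0 := by linarith
  have hN2 : (N : ℝ) - 2 ≠ 0 := by linarith
  have hD0 : (D : ℝ) ≠ 0 := by linarith
  have hND : (N : ℝ) - D ≠ 0 := by linarith
  refine ⟨D / N * n₀, (D - 1) / (N - 1) * (D / N * n₀),
    (D - 2) / (N - 2) * ((D - 1) / (N - 1) * (D / N * n₀)), ?_, ?_, ?_⟩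
  · rw [← sub_ne_zero]
    have : D / N * n₀ - (D - 1) / (N - 1) * (D / N * n₀) =
        D / N * n₀ * ((N - D) / (N - 1)) := by field_simp; ring
    rw [this]
    positivity
  · intro hne
    have h2D : (N : ℝ) - 2 * D ≠ 0 := by
      rw [sub_ne_zero]; exact_mod_cast hne
    -- The factor `N - 2D` is what separates the two cases of the theorem.
    have : D / N * n₀ - 3 * ((D - 1) / (N - 1) * (D / N * n₀)) +
        2 * ((D - 2) / (N - 2) * ((D - 1) / (N - 1) * (D / N * n₀))) =
        D / N * n₀ * ((N - D) * (N - 2 * D) / ((N - 1) * (N - 2))) := by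
      field_simp; ring
    rw [this]
    positivity
  · intro a b c
    by_cases hab : a = b
    · subst hab
      by_cases hac : a = c
      · subst hac
        simp [h1]; ring
      · simp [hac, h2 a c hac]
    · by_cases hac : a = c
      · subst hac
        rw [show ({a, b, a} : Finset (Fin N)) = {a, b} by ext; simp; tauto, h2 a b hab]
        simp [hab, Ne.symm hab]
      · by_cases hbc : b = c
        · subst hbc
          simp [hab, h2 a b hab]
        · simp [hab, hac, hbc, h3 a b c hab hac hbc]

/-- The vector `z ↦ |x ∩ z| - D² / N`, a multiple of the projection of `x̂` onto the eigenspace of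
`θ₁`. -/
noncomputable def interVec {N D : ℕ} (x : {s : Finset (Fin N) // s.card = D}) :
    EuclideanSpace ℝ {s : Finset (Fin N) // s.card = D} :=
  WithLp.toLp 2 fun z => ((x.1 ∩ z.1).card : ℝ) - D ^ 2 / N

lemma johnsonIdempotent_interVec {N D : ℕ} (hD : 1 ≤ D) (hN : D < N)
    (x : {s : Finset (Fin N) // s.card = D}) :
    johnsonIdempotent N D 1 (interVec x) = interVec x := by
  unfold johnsonIdempotent primitiveIdempotent
  rw [Submodule.starProjection_eq_self_iff, mem_eigenspace_johnsonGraph hD hN]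
  have hN0 : (N : ℝ) ≠ 0 := by
    have : N ≠ 0 := by omega
    exact_mod_cast this
  -- The indicator of `x`, shifted to have sum zero.
  refine ⟨fun a => (if a ∈ x.1 then 1 else 0) - D / N, ?_, fun z => ?_⟩
  · simp only [sum_sub_distrib, sum_boole, filter_univ_mem, x.2, sum_const, card_univ,
      Fintype.card_fin, nsmul_eq_mul]
    field_simp
    ring
  · simp only [sum_sub_distrib, sum_boole, filter_mem_eq_inter, z.2, sum_const, nsmul_eq_mul,
      interVec]
    rw [inter_comm]
    ring

/-- The triple count `∑ |x ∩ z| |y ∩ z|` over the vertices `z` that contain `a`. -/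
lemma sum_card_inter_mul_card_inter {N D : ℕ} (x y : Finset (Fin N)) (a : Fin N) :
    ∑ z : {s : Finset (Fin N) // s.card = D},
        (if a ∈ z.1 then ((x ∩ z.1).card : ℝ) * (y ∩ z.1).card else 0) =
      ∑ b ∈ x, ∑ c ∈ y, supersetSum (D := D) (fun _ => 1) {a, b, c} := by
  unfold supersetSum
  rw [sum_congr rfl fun b _ => sum_comm, sum_comm]
  refine sum_congr rfl fun z _ => ?_
  simp only [insert_subset_iff, singleton_subset_iff]
  by_cases ha : a ∈ z.1
  · simp only [ha, if_true, true_and, ← filter_mem_eq_inter]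
    rw [← sum_boole, ← sum_boole, sum_mul_sum]
    exact sum_congr rfl fun b _ => sum_congr rfl fun c _ => by
      by_cases hb : b ∈ z.1 <;> by_cases hc : c ∈ z.1 <;> simp [hb, hc]
  · simp [ha]

/-- The repeated `a` lets the triple-count formula handle pairs too. -/
lemma sum_card_inter {N D : ℕ} (x : Finset (Fin N)) (a : Fin N) :
    ∑ z : {s : Finset (Fin N) // s.card = D},
        (if a ∈ z.1 then ((x ∩ z.1).card : ℝ) else 0) =
      ∑ b ∈ x, supersetSum (D := D) (fun _ => 1) {a, a, b} := by
  unfold supersetSum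
  rw [sum_comm]
  refine sum_congr rfl fun z _ => ?_
  simp only [insert_subset_iff, singleton_subset_iff]
  by_cases ha : a ∈ z.1
  · simp only [ha, if_true, true_and, ← filter_mem_eq_inter]
    rw [← sum_boole]
  · simp [ha]

/-- The projection of `x̂` up to a scalar, and the Norton product up to
terms in `E x̂` and `E ŷ`. -/
lemma exists_marginal_interVec {N D : ℕ} (hD : 1 ≤ D) (hN : D < N) (hN3 : 3 ≤ N) :
    ∃ α γ : ℝ, α ≠ 0 ∧ (N ≠ 2 * D → γ ≠ 0) ∧
      (∀ x : {s : Finset (Fin N) // s.card = D},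
        α • johnsonIdempotent N D 1 (hat x) = interVec x) ∧
      ∀ x y : {s : Finset (Fin N) // s.card = D}, ∃ p q r : ℝ, ∀ a,
        marginal (entrywise (interVec x) (interVec y)) a =
          p * (if a ∈ x.1 then 1 else 0) + q * (if a ∈ y.1 then 1 else 0) +
            γ * ((if a ∈ x.1 then 1 else 0) * (if a ∈ y.1 then 1 else 0)) + r := by
  obtain ⟨n₁, n₂, n₃, h12, hγ, hn⟩ := exists_supersetSum_one hD hN hN3
  have h1 : ∀ a : Fin N, ∑ z : {s : Finset (Fin N) // s.card = D},
      (if a ∈ z.1 then (1 : ℝ) else 0) = n₁ := by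
    intro a
    have := hn a a a
    simp only [supersetSum, insert_subset_iff, singleton_subset_iff, and_self, if_true] at this
    rw [this]; ring
  have h2 : ∀ (x : {s : Finset (Fin N) // s.card = D}) (a : Fin N),
      ∑ z : {s : Finset (Fin N) // s.card = D},
        (if a ∈ z.1 then ((x.1 ∩ z.1).card : ℝ) else 0) =
      (n₁ - n₂) * (if a ∈ x.1 then 1 else 0) + n₂ * D := by
    intro x a
    rw [sum_card_inter]
    simp only [hn, if_true, one_mul, sum_add_distrib, ← mul_sum, sum_const, sum_ite_eq,
      nsmul_eq_mul, x.2]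
    ring
  -- `n₁ - n₂` is the coefficient of `1_x` in the marginal of `interVec x`; the second witness is
  -- the coefficient of the triple coincidence `a = b = c`, the source of `1_{x∩y}`.
  refine ⟨n₁ - n₂, n₁ - 3 * n₂ + 2 * n₃, sub_ne_zero.2 h12, hγ, fun x => ?_, fun x y => ?_⟩
  · rw [← johnsonIdempotent_interVec hD hN x, ← sub_eq_zero, ← map_smul, ← map_sub]
    refine johnsonIdempotent_eq_zero hD hN _ (-(n₂ * D) + D ^ 2 / N * n₁) fun a => ?_
    have h : marginal (interVec x) a = ∑ z : {s : Finset (Fin N) // s.card = D},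
        ((if a ∈ z.1 then ((x.1 ∩ z.1).card : ℝ) else 0) -
          D ^ 2 / N * (if a ∈ z.1 then (1 : ℝ) else 0)) := by
      rw [marginal_apply]
      exact sum_congr rfl fun z _ => by split_ifs <;> simp [interVec]
    rw [map_sub, map_smul, Pi.sub_apply, Pi.smul_apply, marginal_hat, h, sum_sub_distrib, ← mul_sum,
      h1, h2, smul_eq_mul]
    ring
  · have h : ∀ a, marginal (entrywise (interVec x) (interVec y)) a =
        ∑ z : {s : Finset (Fin N) // s.card = D},
        ((if a ∈ z.1 then ((x.1 ∩ z.1).card : ℝ) * (y.1 ∩ z.1).card else 0) -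
          D ^ 2 / N * (if a ∈ z.1 then ((x.1 ∩ z.1).card : ℝ) else 0) -
          D ^ 2 / N * (if a ∈ z.1 then ((y.1 ∩ z.1).card : ℝ) else 0) +
          (D ^ 2 / N) ^ 2 * (if a ∈ z.1 then (1 : ℝ) else 0)) := by
      intro a
      rw [marginal_apply]
      refine sum_congr rfl fun z _ => ?_
      split_ifs
      · simp only [entrywise, interVec]; ring
      · ring
    refine ⟨(n₂ - n₃) * D - D ^ 2 / N * (n₁ - n₂), (n₂ - n₃) * D - D ^ 2 / N * (n₁ - n₂),
      n₃ * D ^ 2 + (n₂ - n₃) * (x.1 ∩ y.1).card - 2 * (D ^ 2 / N * (n₂ * D)) +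
        (D ^ 2 / N) ^ 2 * n₁, fun a => ?_⟩
    rw [h, sum_add_distrib, sum_sub_distrib, sum_sub_distrib, ← mul_sum, ← mul_sum, ← mul_sum, h1,
      h2, h2, sum_card_inter_mul_card_inter]
    simp only [hn, sum_add_distrib, ← mul_sum, ← sum_mul, sum_const, sum_ite_eq, nsmul_eq_mul,
      x.2, y.2, sum_boole, filter_mem_eq_inter]
    ring

/-! ### Symmetries of the sphere intersections -/

/-- The action of a permutation of the ground set on the vertices of `J(N, D)`. -/
def permVertex {N D : ℕ} (π : Equiv.Perm (Fin N)) :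
    Equiv.Perm {s : Finset (Fin N) // s.card = D} :=
  (Equiv.finsetCongr π).subtypeEquiv fun s => by simp

lemma mem_permVertex {N D : ℕ} (π : Equiv.Perm (Fin N)) (z : {s : Finset (Fin N) // s.card = D})
    (a : Fin N) : π a ∈ (permVertex π z).1 ↔ a ∈ z.1 := by
  simp [permVertex]

/-- Complementation on the vertices of `J(2D, D)`. -/
def complVertex {N D : ℕ} (hN : N = 2 * D) : Equiv.Perm {s : Finset (Fin N) // s.card = D} :=
  Function.Involutive.toPerm
    (fun z => ⟨z.1ᶜ, by rw [card_compl, Fintype.card_fin, z.2]; omega⟩)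
    (fun z => Subtype.ext (compl_compl z.1))

lemma mem_complVertex {N D : ℕ} (hN : N = 2 * D) (z : {s : Finset (Fin N) // s.card = D})
    (a : Fin N) : a ∈ (complVertex hN z).1 ↔ a ∉ z.1 :=
  mem_compl

lemma card_inter_permVertex {N D : ℕ} (π : Equiv.Perm (Fin N)) (x : Finset (Fin N))
    (z : {s : Finset (Fin N) // s.card = D}) :
    (x ∩ (permVertex π z).1).card = (z.1.filter fun t => π t ∈ x).card := by
  refine (card_bij (fun t _ => π t) ?_ (fun _ _ _ _ h => π.injective h) ?_).symm
  · intro t ht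
    rw [mem_filter] at ht
    exact mem_inter.2 ⟨ht.2, (mem_permVertex π z t).2 ht.1⟩
  · intro b hb
    obtain ⟨t, rfl⟩ := π.surjective b
    rw [mem_inter, mem_permVertex] at hb
    exact ⟨t, mem_filter.2 hb.symm, rfl⟩

lemma marginal_sumInter_perm {N D : ℕ} (x y : {s : Finset (Fin N) // s.card = D}) (i j : ℤ)
    (π : Equiv.Perm (Fin N)) (hx : ∀ t, π t ∈ x.1 ↔ t ∈ x.1) (hy : ∀ t, π t ∈ y.1 ↔ t ∈ y.1)
    (a : Fin N) :
    marginal (sumInter (johnsonGraph N D) i j x y) (π a) =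
      marginal (sumInter (johnsonGraph N D) i j x y) a := by
  rw [marginal_sumInter, marginal_sumInter]
  symm
  refine Fintype.sum_equiv (permVertex π) _ _ fun z => if_congr ?_ rfl rfl
  rw [mem_permVertex, card_inter_permVertex, card_inter_permVertex]
  simp only [hx, hy, filter_mem_eq_inter, inter_comm]

/-- The transposition of `a` and `b` preserves both `x` and `y`. -/
lemma marginal_sumInter_congr {N D : ℕ} (x y : {s : Finset (Fin N) // s.card = D}) (i j : ℤ)
    (a b : Fin N) (hx : a ∈ x.1 ↔ b ∈ x.1) (hy : a ∈ y.1 ↔ b ∈ y.1) :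
    marginal (sumInter (johnsonGraph N D) i j x y) a =
      marginal (sumInter (johnsonGraph N D) i j x y) b := by
  have h : ∀ s : Finset (Fin N), (a ∈ s ↔ b ∈ s) → ∀ t, Equiv.swap a b t ∈ s ↔ t ∈ s := by
    intro s hs t
    rw [Equiv.swap_apply_def]
    split_ifs with h1 h2
    · rw [h1, hs]
    · rw [h2, hs]
    · rfl
  rw [← marginal_sumInter_perm x y i j (Equiv.swap a b) (h _ hx) (h _ hy) a,
    Equiv.swap_apply_left]

/-- The map `z ↦ (π z)ᶜ` preserves `|x ∩ z|` and `|y ∩ z|`, and its image contains `π a` exactly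
when `a ∉ z`. So the two marginals together count every `z` once. -/
lemma marginal_sumInter_add_of_perm {N D : ℕ} (hN : N = 2 * D)
    (x y : {s : Finset (Fin N) // s.card = D}) (i j : ℤ)
    (π : Equiv.Perm (Fin N)) (hx : ∀ t, π t ∈ x.1 ↔ t ∉ x.1) (hy : ∀ t, π t ∈ y.1 ↔ t ∉ y.1)
    (a : Fin N) :
    marginal (sumInter (johnsonGraph N D) i j x y) a +
      marginal (sumInter (johnsonGraph N D) i j x y) (π a) =
      ∑ z : {s : Finset (Fin N) // s.card = D}, if ((x.1 ∩ z.1).card : ℤ) = D - i ∧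
        ((y.1 ∩ z.1).card : ℤ) = D - j then 1 else 0 := by
  have hcard : ∀ x : {s : Finset (Fin N) // s.card = D}, (∀ t, π t ∈ x.1 ↔ t ∉ x.1) →
      ∀ z, (x.1 ∩ (complVertex hN (permVertex π z)).1).card = (x.1 ∩ z.1).card := by
    intro x hx z
    have h1 : x.1 ∩ (complVertex hN (permVertex π z)).1 = x.1 \ (permVertex π z).1 := by
      ext t; simp [mem_complVertex]
    have h2 := card_inter_add_card_sdiff x.1 (permVertex π z).1
    rw [card_inter_permVertex] at h2
    simp only [hx] at h2
    have h3 := card_filter_add_card_filter_not (s := z.1) (fun t => t ∈ x.1)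
    rw [filter_mem_eq_inter, inter_comm] at h3
    rw [h1]
    have := x.2
    have := z.2
    omega
  rw [marginal_sumInter, marginal_sumInter]
  rw [← Equiv.sum_comp ((permVertex π).trans (complVertex hN))
    (fun z => if (((x.1 ∩ z.1).card : ℤ) = D - i ∧ ((y.1 ∩ z.1).card : ℤ) = D - j) ∧
      π a ∈ z.1 then (1 : ℝ) else 0), ← sum_add_distrib]
  refine sum_congr rfl fun z _ => ?_
  have hmem : π a ∈ (complVertex hN (permVertex π z)).1 ↔ a ∉ z.1 := by
    rw [mem_complVertex, mem_permVertex]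
  simp only [Equiv.trans_apply, hcard x hx, hcard y hy, hmem]
  by_cases h : ((x.1 ∩ z.1).card : ℤ) = D - i ∧ ((y.1 ∩ z.1).card : ℤ) = D - j <;>
    by_cases h' : a ∈ z.1 <;> simp [h, h']

/-- For `N = 2D` opposite cells of the Venn diagram have equal size: `x ∩ y` and the complement of
`x ∪ y`, `x \ y` and `y \ x`. Matching fibres of the membership pattern with those of its negation
gives `π`. -/
lemma exists_perm_compl {N D : ℕ} (hN : N = 2 * D) (x y : {s : Finset (Fin N) // s.card = D}) :
    ∃ π : Equiv.Perm (Fin N), (∀ t, π t ∈ x.1 ↔ t ∉ x.1) ∧ (∀ t, π t ∈ y.1 ↔ t ∉ y.1) := by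
  let f : Fin N → Bool × Bool := fun t => (decide (t ∉ x.1), decide (t ∉ y.1))
  let g : Fin N → Bool × Bool := fun t => (decide (t ∈ x.1), decide (t ∈ y.1))
  have hc1 := card_inter_add_card_sdiff x.1 y.1
  have hc2 := card_sdiff_eq x y
  have hc3 := card_inter_add_card_sdiff x.1ᶜ y.1
  have hc4 := card_add_card_compl x.1
  rw [Fintype.card_fin] at hc4
  have hx := x.2
  have h1 : univ.filter (fun t => t ∈ x.1 ∧ t ∈ y.1) = x.1 ∩ y.1 := by ext; simp
  have h2 : univ.filter (fun t => t ∈ x.1 ∧ t ∉ y.1) = x.1 \ y.1 := by ext; simp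
  have h3 : univ.filter (fun t => t ∉ x.1 ∧ t ∈ y.1) = y.1 \ x.1 := by ext; simp [and_comm]
  have h4 : univ.filter (fun t => t ∉ x.1 ∧ t ∉ y.1) = x.1ᶜ \ y.1 := by ext; simp
  have h5 : x.1ᶜ ∩ y.1 = y.1 \ x.1 := by ext; simp [and_comm]
  rw [h5] at hc3
  have hcard : ∀ c, Fintype.card {t // f t = c} = Fintype.card {t // g t = c} := by
    rintro ⟨u, v⟩
    rw [Fintype.card_subtype, Fintype.card_subtype]
    cases u <;> cases v <;>
      simp only [f, g, Prod.mk.injEq, decide_eq_true_eq, decide_eq_false_iff_not, not_not, h1, h2,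
        h3, h4] <;> omega
  let π : Equiv.Perm (Fin N) := Equiv.ofFiberEquiv fun c => Fintype.equivOfCardEq (hcard c)
  have hπ : ∀ t, g (π t) = f t := fun t => Equiv.ofFiberEquiv_map _ t
  refine ⟨π, fun t => ?_, fun t => ?_⟩
  · exact decide_eq_decide.1 (congrArg Prod.fst (hπ t))
  · exact decide_eq_decide.1 (congrArg Prod.snd (hπ t))

/-- The marginal of `∑ ẑ` over `z ∈ Γ_i(x) ∩ Γ_j(y)` is a combination of the indicators of `x`,
`y`, `x ∩ y` and the constants; for `N = 2 D` the indicator of `x ∩ y` is not needed. -/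
lemma exists_marginal_sumInter {N D : ℕ} (x y : {s : Finset (Fin N) // s.card = D}) (i j : ℤ) :
    ∃ p q c r : ℝ, (N = 2 * D → c = 0) ∧ ∀ a,
      marginal (sumInter (johnsonGraph N D) i j x y) a =
        p * (if a ∈ x.1 then 1 else 0) + q * (if a ∈ y.1 then 1 else 0) +
          c * ((if a ∈ x.1 then 1 else 0) * (if a ∈ y.1 then 1 else 0)) + r := by
  classical
  set S := marginal (sumInter (johnsonGraph N D) i j x y) with hS
  have hF : ∃ F : Prop → Prop → ℝ, ∀ a, S a = F (a ∈ x.1) (a ∈ y.1) := by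
    refine ⟨fun u v => if h : ∃ a, (a ∈ x.1 ↔ u) ∧ (a ∈ y.1 ↔ v) then S h.choose else 0,
      fun a => ?_⟩
    have h : ∃ b, (b ∈ x.1 ↔ a ∈ x.1) ∧ (b ∈ y.1 ↔ a ∈ y.1) := ⟨a, Iff.rfl, Iff.rfl⟩
    refine Eq.trans ?_ (dif_pos h).symm
    exact marginal_sumInter_congr x y i j _ _ h.choose_spec.1.symm h.choose_spec.2.symm
  obtain ⟨F, hF⟩ := hF
  -- `F` takes the default value 0 on membership patterns that no element realises, so disjoint `x`,
  -- `y` and `x = y` are split off; there `c = 0` can be chosen outright.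
  by_cases hdisj : ∃ t, t ∈ x.1 ∧ t ∈ y.1
  swap
  · refine ⟨F True False - F False False, F False True - F False False, 0, F False False,
      fun _ => rfl, fun a => ?_⟩
    rw [hF]
    by_cases h1 : a ∈ x.1 <;> by_cases h2 : a ∈ y.1
    · exact absurd ⟨a, h1, h2⟩ hdisj
    all_goals simp [h1, h2]
  by_cases hsub : ∃ t, t ∈ x.1 ∧ t ∉ y.1
  swap
  · have hxy : x = y := Subtype.ext (eq_of_subset_of_card_le
      (fun t ht => by by_contra h; exact hsub ⟨t, ht, h⟩) (by rw [x.2, y.2]))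
    subst hxy
    refine ⟨F True True - F False False, 0, 0, F False False, fun _ => rfl, fun a => ?_⟩
    rw [hF]
    by_cases h1 : a ∈ x.1 <;> simp [h1]
  refine ⟨F True False - F False False, F False True - F False False,
    F True True - F True False - F False True + F False False, F False False,
    fun hN => ?_, fun a => ?_⟩
  -- `π` pairs the cell of `s` with the outside and the cell of `t` with `y \ x`. Both pairs have
  -- the same total, so the alternating sum defining `c` vanishes.
  · obtain ⟨s, hsx, hsy⟩ := hdisj
    obtain ⟨t, htx, hty⟩ := hsub
    obtain ⟨π, hπx, hπy⟩ := exists_perm_compl hN x y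
    have h1 := marginal_sumInter_add_of_perm hN x y i j π hπx hπy s
    have h2 := marginal_sumInter_add_of_perm hN x y i j π hπx hπy t
    rw [← hS] at h1 h2
    simp only [hF, hπx, hπy, hsx, hsy, htx, hty, not_true_eq_false, not_false_eq_true] at h1 h2
    linarith
  · rw [hF]
    by_cases h1 : a ∈ x.1 <;> by_cases h2 : a ∈ y.1 <;> simp [h1, h2] <;> ring

/-! ### Norton-balance -/

lemma isNortonBalanced_johnsonGraph {N D : ℕ} (hD : 1 ≤ D) (hN : D < N) (hN3 : 3 ≤ N) :
    IsNortonBalanced (johnsonGraph N D) (johnsonIdempotent N D 1) := by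
  intro x y i j
  rw [← map_sum]
  change johnsonIdempotent N D 1 (sumInter (johnsonGraph N D) i j x y) ∈ _
  obtain ⟨α, γ, hα, hγ, hE, hM⟩ := exists_marginal_interVec hD hN hN3
  obtain ⟨p, q, c, r, hc, hS⟩ := exists_marginal_sumInter x y i j
  obtain ⟨p', q', r', hW⟩ := hM x y
  set M := Submodule.span ℝ {johnsonIdempotent N D 1 (hat x), johnsonIdempotent N D 1 (hat y),
    nortonProduct (johnsonIdempotent N D 1) (johnsonIdempotent N D 1 (hat x))
      (johnsonIdempotent N D 1 (hat y))} with hMdef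
  have hx : johnsonIdempotent N D 1 (hat x) ∈ M := Submodule.subset_span (by simp)
  have hy : johnsonIdempotent N D 1 (hat y) ∈ M := Submodule.subset_span (by simp)
  have hxy : johnsonIdempotent N D 1 (entrywise (interVec x) (interVec y)) ∈ M := by
    have h : entrywise (interVec x) (interVec y) = (α * α) • entrywise
        (johnsonIdempotent N D 1 (hat x)) (johnsonIdempotent N D 1 (hat y)) := by
      rw [← hE, ← hE]
      ext z
      simp only [entrywise, PiLp.smul_apply, smul_eq_mul]
      ring
    rw [h, map_smul]
    exact M.smul_mem _ (Submodule.subset_span (by simp [nortonProduct]))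
  -- Subtracting `k` times the product vector removes the `1_{x∩y}` term; for `N = 2D` there is none
  -- to remove.
  obtain ⟨k, hk⟩ : ∃ k : ℝ, k * γ = c := by
    by_cases h : N = 2 * D
    · exact ⟨0, by rw [hc h, zero_mul]⟩
    · exact ⟨c / γ, div_mul_cancel₀ _ (hγ h)⟩
  have hcomb := johnsonIdempotent_eq_combination hD hN
    (sumInter (johnsonGraph N D) i j x y - k • entrywise (interVec x) (interVec y)) x y
    (p - k * p') (q - k * q') (r - k * r') (fun a => by
      rw [map_sub, map_smul, Pi.sub_apply, Pi.smul_apply, hS, hW, smul_eq_mul, ← hk]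
      ring)
  rw [map_sub, map_smul, sub_eq_iff_eq_add] at hcomb
  rw [hcomb]
  exact M.add_mem (M.add_mem (M.smul_mem _ hx) (M.smul_mem _ hy)) (M.smul_mem _ hxy)

end NortonBalanced

end

theorem mainTheorem7 (N D : ℕ) (hD : 3 ≤ D) (hN : 2 * D ≤ N) :
    (∀ (x y : {s : Finset (Fin N) // s.card = D}) (i : ℕ),
      (johnsonGraph N D).dist x y = i → 2 ≤ i → i ≤ D →
        NortonBalanced.johnsonIdempotent N D 1
            (NortonBalanced.xMinus (johnsonGraph N D) x y) =
          ((i : ℝ) * ((i : ℝ) - 1)) •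
              NortonBalanced.johnsonIdempotent N D 1 (NortonBalanced.hat x) +
            (i : ℝ) • NortonBalanced.johnsonIdempotent N D 1 (NortonBalanced.hat y)) ∧
    (N = 2 * D →
      ∀ (x y : {s : Finset (Fin N) // s.card = D}) (i : ℕ),
        (johnsonGraph N D).dist x y = i → 1 ≤ i → i ≤ D - 1 →
          NortonBalanced.johnsonIdempotent N D 1
              (NortonBalanced.xPlus (johnsonGraph N D) x y) =
            (((D : ℝ) - i) * ((D : ℝ) - i - 1)) •
                NortonBalanced.johnsonIdempotent N D 1 (NortonBalanced.hat x) +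
              ((i : ℝ) - D) •
                NortonBalanced.johnsonIdempotent N D 1 (NortonBalanced.hat y)) ∧
    NortonBalanced.IsNortonBalanced (johnsonGraph N D)
      (NortonBalanced.johnsonIdempotent N D 1) := by
  have hDN : D < N := by omega
  refine ⟨fun x y i hi _ _ => ?_, fun hN2 x y i hi _ _ => ?_, ?_⟩
  · exact NortonBalanced.johnsonIdempotent_xMinus (by omega) hDN x y i hi
  · exact NortonBalanced.johnsonIdempotent_xPlus (by omega) hN2 x y i hi
  · exact NortonBalanced.isNortonBalanced_johnsonGraph (by omega) hDN (by omega)
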